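/- Let $c\in\mathbb Z^n$, $d\in\mathbb Z^\ell$, $A\in\mathbb Z^{m\times n}$, $B\in\mathbb Z^{m\times\ell}$, $g\in\mathbb Z^m$ and consider the mixed-integer problem $$\min\{c^\top x+d^\top y : Ax+By\ge g,\ x\ge 0,\ y\ge 0,\ y\in\mathbb Z^\ell\}\qquad(1)$$ over real vectors $x$, $y$. Let $\Delta\ge 1$ be an integer such that $A$ is $\Delta$-regular, i.e. $\Delta R^{-1}$ is integral for every non-singular square submatrix $R$ of $A$, and assume that the feasible set of the LP relaxation of (1) is a (possibly empty) polytope. Let a decomposition of $(A\ B)$ into $k$ blocks with linking rows and without linking columns be given: every column belongs to one block, every row either belongs to one block or is a linking row, and a row of block $q$ has nonzero entries only in columns of block $q$. Write $A_q,B_q,g_q,c_q,d_q,x_q,y_q$ for the parts belonging to block $q$, and $A_q^{\mathrm{row},j}$, $B_q^{\mathrm{row},j}$ for the columns of block $q$ in the linking row $j$. *Decomposition Branching utilizing $\Delta$-regularity* is the following branch-and-bound algorithm in exact arithmetic. A node is given by finitely many branching inequalities, each of them on the variables of one block. Initially only the root node (without branching inequalities) is pending and there is no incumbent. In each iteration some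 pending node is removed and processed as follows. 1. If the LP relaxation of the node (the LP relaxation of (1) with the node's branching inequalities added) is infeasible, the node is pruned. Otherwise let $(x^{LP},y^{LP})$ be any optimal solution of it. If its value is larger than that of the incumbent, the node is pruned (if the values are equal, pruning is allowed but not required). 2. If the node is not pruned and $y^{LP}$ is integral, $(x^{LP},y^{LP})$ is a candidate solution and the node is pruned. 3. Otherwise, for a block $q$ with non-integral $y^{LP}_q$ the branching subproblem is to minimize $c_q^\top x_q+d_q^\top y_q$ subject to $A_qx_q+B_qy_q\ge g_q$, the node's branching inequalities on block $q$, $A_q^{\mathrm{row},j}x_q+B_q^{\mathrm{row},j}y_q\ge A_q^{\mathrm{row},j}x^{LP}_q+B_q^{\mathrm{row},j}y^{LP}_q$ for every linking row $j$, $x_q\ge0$, $y_q\ge 0$, $y_q$ integral; let $z_q^*$ be its optimal value ($+\infty$ if it is infeasible) and, if it is feasible, $(x_q^*,y_q^*)$ any optimal solution. For a block $q$ with integral $y_q^{LP}$ put $(x_q^*,y_q^*)=(x_q^{LP},y_q^{LP})$ and $z_q^*=c_q^\top x_q^{LP}+d_q^\top y_q^{LP}$. * If $z_q^*=c_q^\top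 x_q^{LP}+d_q^\top y_q^{LP}$ for all $q$, then $(x_1^*,\dots,x_k^*,y_1^*,\dots,y_k^*)$ is a candidate solution and the node is pruned. * Otherwise a block $q$ with $z_q^*>c_q^\top x_q^{LP}+d_q^\top y_q^{LP}$ is chosen (the first one in an arbitrary order of inspection), and the node is replaced by the following child nodes, each of which has one additional inequality: for every linking row $j$ a child with $$A_q^{\mathrm{row},j}x_q+B_q^{\mathrm{row},j}y_q\le\frac{\lceil\Delta(A_q^{\mathrm{row},j}x_q^{LP}+B_q^{\mathrm{row},j}y_q^{LP})\rceil-1}{\Delta},$$ and, if $z_q^*<\infty$, one child with $$c_q^\top x_q+d_q^\top y_q\ge\frac{\lceil\Delta z_q^*\rceil}{\Delta}.$$ A candidate solution replaces the incumbent if there is no incumbent or if its value is smaller. The algorithm stops when no node is pending and returns the incumbent. **Theorem.** For every order of node processing and every choice of optimal LP and subproblem solutions and of branching blocks, the algorithm can always proceed while a node is pending, and it terminates after finitely many iterations (their number being bounded by a constant that depends only on the problem data, the decomposition and $\Delta$). When it terminates, an incumbent, if there is one, is an optimal solution of (1), and there is no incumbent if and only if (1) is infeasible; in particular, an optimal solution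 is returned whenever one exists. -/

import Mathlib

namespace DecBranch

/-- A rational matrix `A` is `Δ`-regular if `Δ • R⁻¹` is integral for each of its non-singular
square submatrices `R`. -/
def IsDeltaRegular {m n : ℕ} (Δ : ℕ) (A : Matrix (Fin m) (Fin n) ℚ) : Prop :=
  ∀ (w : ℕ) (r : Fin w ↪ Fin m) (s : Fin w ↪ Fin n),
    (A.submatrix r s).det ≠ 0 →
      ∀ i j, ∃ z : ℤ, (Δ : ℚ) * (A.submatrix r s)⁻¹ i j = (z : ℚ)

/-- Integral data of the mixed-integer linear problem
`min {cᵀx + dᵀy | A x + B y ≥ g, x ≥ 0, y ≥ 0, y integral}`. -/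
structure MIP (m n l : ℕ) where
  c : Fin n → ℤ
  d : Fin l → ℤ
  A : Matrix (Fin m) (Fin n) ℤ
  B : Matrix (Fin m) (Fin l) ℤ
  g : Fin m → ℤ

/-- A pair `(x, y)` of real vectors. -/
abbrev Point (n l : ℕ) : Type := (Fin n → ℝ) × (Fin l → ℝ)

namespace MIP

variable {m n l : ℕ} (P : MIP m n l)

/-- The objective value `cᵀx + dᵀy`. -/
def value (p : Point n l) : ℝ :=
  ∑ j, (P.c j : ℝ) * p.1 j + ∑ j, (P.d j : ℝ) * p.2 j

/-- The feasible set of the LP relaxation. -/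
def lpFeasible : Set (Point n l) :=
  {p | (∀ i, (P.g i : ℝ) ≤ ∑ j, (P.A i j : ℝ) * p.1 j + ∑ j, (P.B i j : ℝ) * p.2 j) ∧
    (∀ j, 0 ≤ p.1 j) ∧ (∀ j, 0 ≤ p.2 j)}

/-- The feasible set of the mixed-integer problem. -/
def feasible : Set (Point n l) :=
  {p | p ∈ P.lpFeasible ∧ ∀ j, ∃ z : ℤ, p.2 j = (z : ℝ)}

/-- `p` is an optimal solution of the mixed-integer problem. -/
def IsOptimal (p : Point n l) : Prop :=
  p ∈ P.feasible ∧ ∀ p' ∈ P.feasible, P.value p ≤ P.value p'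

end MIP

/-- A decomposition of `(A B)` with `k` blocks, linking rows and no linking columns: every column
belongs to one block, every row belongs to one block (`some q`) or is a linking row (`none`), and a
row of block `q` has nonzero entries only in columns of block `q`. -/
structure Decomposition {m n l : ℕ} (P : MIP m n l) (k : ℕ) where
  colX : Fin n → Fin k
  colY : Fin l → Fin k
  row : Fin m → Option (Fin k)
  A_eq_zero : ∀ i j q, row i = some q → colX j ≠ q → P.A i j = 0
  B_eq_zero : ∀ i j q, row i = some q → colY j ≠ q → P.B i j = 0

namespace Decomposition

variable {m n l k : ℕ} {P : MIP m n l} (D : Decomposition P k)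

/-- The pairs `(x_q, y_q)` of vectors of variables of block `q`. -/
abbrev BlockPoint (q : Fin k) : Type :=
  ({j : Fin n // D.colX j = q} → ℝ) × ({j : Fin l // D.colY j = q} → ℝ)

/-- The part `(x_q, y_q)` of `(x, y)`. -/
def restrict (q : Fin k) (p : Point n l) : D.BlockPoint q :=
  (fun j => p.1 j.1, fun j => p.2 j.1)

/-- The point `(x, y)` with the given parts `(x_q, y_q)`. -/
def combine (v : ∀ q, D.BlockPoint q) : Point n l :=
  (fun j => (v (D.colX j)).1 ⟨j, rfl⟩, fun j => (v (D.colY j)).2 ⟨j, rfl⟩)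

/-- The value of the columns of block `q` in row `i` of `A x + B y`. -/
def blockRow (q : Fin k) (i : Fin m) (v : D.BlockPoint q) : ℝ :=
  ∑ j, (P.A i j.1 : ℝ) * v.1 j + ∑ j, (P.B i j.1 : ℝ) * v.2 j

/-- The value `c_qᵀ x_q + d_qᵀ y_q`. -/
def blockValue (q : Fin k) (v : D.BlockPoint q) : ℝ :=
  ∑ j, (P.c j.1 : ℝ) * v.1 j + ∑ j, (P.d j.1 : ℝ) * v.2 j

/-- `y_q` is integral. -/
def IntegralBlock (q : Fin k) (v : D.BlockPoint q) : Prop :=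
  ∀ j, ∃ z : ℤ, v.2 j = (z : ℝ)

/-- The index type of the linking rows. -/
abbrev LinkRow : Type := {i : Fin m // D.row i = none}

/-- A branching inequality on the variables of one block `q`: either
`A_q^{row,j} x_q + B_q^{row,j} y_q ≤ rhs` or `c_qᵀ x_q + d_qᵀ y_q ≥ rhs`. -/
inductive Cut where
  | link (j : D.LinkRow) (rhs : ℝ)
  | obj (rhs : ℝ)

/-- `(x_q, y_q)` satisfies a branching inequality of block `q`. -/
def CutHolds (q : Fin k) (v : D.BlockPoint q) : D.Cut → Prop
  | .link j rhs => D.blockRow q j.1 v ≤ rhs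
  | .obj rhs => rhs ≤ D.blockValue q v

/-- A node of the branch-and-bound tree: the list of the branching inequalities (each with its
block) that were added on the way from the root. -/
abbrev Node : Type := List (Fin k × D.Cut)

/-- The feasible set of the LP relaxation at a node. -/
def nodeLP (N : D.Node) : Set (Point n l) :=
  {p | p ∈ P.lpFeasible ∧ ∀ e ∈ N, D.CutHolds e.1 (D.restrict e.1 p) e.2}

/-- `p` is an optimal solution of the LP relaxation at a node. -/
def IsLPSolution (N : D.Node) (p : Point n l) : Prop :=
  p ∈ D.nodeLP N ∧ ∀ p' ∈ D.nodeLP N, P.value p ≤ P.value p'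

/-- The feasible set of the branching subproblem of block `q` at node `N` with LP solution `p`.
A branching inequality involves the variables of one block only, so at node `N` the branching
inequalities of block `q` count among the constraints of block `q`. -/
def subFeasible (N : D.Node) (p : Point n l) (q : Fin k) : Set (D.BlockPoint q) :=
  {v | (∀ i, D.row i = some q → (P.g i : ℝ) ≤ D.blockRow q i v) ∧
    (∀ b, (q, b) ∈ N → D.CutHolds q v b) ∧
    (∀ i : D.LinkRow, D.blockRow q i.1 (D.restrict q p) ≤ D.blockRow q i.1 v) ∧
    (∀ j, 0 ≤ v.1 j) ∧ (∀ j, 0 ≤ v.2 j) ∧ D.IntegralBlock q v}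

/-- `v = (x_q^*, y_q^*)` is a solution of the branching subproblem of block `q`: the LP solution
itself if `y_q^LP` is integral, and otherwise an optimal solution of the subproblem. Its value
`D.blockValue q v` is `z_q^*`. -/
def IsSubSolution (N : D.Node) (p : Point n l) (q : Fin k) (v : D.BlockPoint q) : Prop :=
  (D.IntegralBlock q (D.restrict q p) ∧ v = D.restrict q p) ∨
  (¬ D.IntegralBlock q (D.restrict q p) ∧ v ∈ D.subFeasible N p q ∧
    ∀ v' ∈ D.subFeasible N p q, D.blockValue q v ≤ D.blockValue q v')

/-- The branching subproblem of block `q` has to be solved and is infeasible. -/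
def SubInfeasible (N : D.Node) (p : Point n l) (q : Fin k) : Prop :=
  ¬ D.IntegralBlock q (D.restrict q p) ∧ D.subFeasible N p q = ∅

/-- The child nodes for the linking constraints, with rounded right-hand sides: one child for each
linking row `j`, with the additional inequality
`A_q^{row,j} x_q + B_q^{row,j} y_q ≤ (⌈Δ (A_q^{row,j} x_q^LP + B_q^{row,j} y_q^LP)⌉ - 1) / Δ`. -/
noncomputable def linkChildren (Δ : ℕ) (N : D.Node) (p : Point n l) (q : Fin k) :
    Multiset D.Node :=
  (Finset.univ : Finset D.LinkRow).val.map fun j =>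
    (q, .link j (((⌈(Δ : ℝ) * D.blockRow q j.1 (D.restrict q p)⌉ : ℝ) - 1) / (Δ : ℝ))) :: N

/-- The child node for the objective function, with the additional inequality
`c_qᵀ x_q + d_qᵀ y_q ≥ ⌈Δ z⌉ / Δ`. -/
noncomputable def objChild (Δ : ℕ) (N : D.Node) (q : Fin k) (z : ℝ) : D.Node :=
  (q, .obj ((⌈(Δ : ℝ) * z⌉ : ℝ) / (Δ : ℝ))) :: N

/-- A state of the branch-and-bound algorithm: the nodes that are still to be processed and the best
solution found so far, if any. -/
structure State where
  pending : Multiset D.Node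
  incumbent : Option (Point n l)

open scoped Classical in
/-- The better one of the current incumbent and a new solution. -/
noncomputable def update (P : MIP m n l) : Option (Point n l) → Point n l → Option (Point n l)
  | none, p => some p
  | some s, p => if P.value p < P.value s then some p else some s

/-- The initial state: only the root node, no incumbent. -/
def init : D.State := ⟨{[]}, none⟩

/-- One iteration of Decomposition Branching with `Δ`-rounding: some pending node `N` is processed.
The order in which nodes are processed, the choice among several optimal solutions of an LP or of a
subproblem, and the order in which the blocks are inspected for branching are arbitrary; an LP value
equal to the incumbent value may, but need not, be used to prune by bound. -/
inductive Step (Δ : ℕ) : D.State → D.State → Prop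
  /-- Pruning by infeasibility of the LP relaxation. -/
  | infeasible (N : D.Node) (rest : Multiset D.Node) (inc : Option (Point n l))
      (hN : D.nodeLP N = ∅) :
      Step Δ ⟨N ::ₘ rest, inc⟩ ⟨rest, inc⟩
  /-- Pruning by bound. -/
  | bound (N : D.Node) (rest : Multiset D.Node) (s p : Point n l)
      (hp : D.IsLPSolution N p) (hs : P.value s ≤ P.value p) :
      Step Δ ⟨N ::ₘ rest, some s⟩ ⟨rest, some s⟩
  /-- Pruning by optimality: the LP solution is integral in `y`. -/
  | integral (N : D.Node) (rest : Multiset D.Node) (inc : Option (Point n l)) (p : Point n l)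
      (hp : D.IsLPSolution N p) (hinc : ∀ s, inc = some s → P.value p ≤ P.value s)
      (hy : ∀ j, ∃ z : ℤ, p.2 j = (z : ℝ)) :
      Step Δ ⟨N ::ₘ rest, inc⟩ ⟨rest, update P inc p⟩
  /-- Pruning by optimality: all branching subproblems have the values of the LP solution. -/
  | blocks (N : D.Node) (rest : Multiset D.Node) (inc : Option (Point n l)) (p : Point n l)
      (hp : D.IsLPSolution N p) (hinc : ∀ s, inc = some s → P.value p ≤ P.value s)
      (hy : ¬ ∀ j, ∃ z : ℤ, p.2 j = (z : ℝ))
      (v : ∀ q, D.BlockPoint q) (hv : ∀ q, D.IsSubSolution N p q (v q))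
      (heq : ∀ q, D.blockValue q (v q) = D.blockValue q (D.restrict q p)) :
      Step Δ ⟨N ::ₘ rest, inc⟩ ⟨rest, update P inc (D.combine v)⟩
  /-- Branching on a block whose subproblem has a larger value than the LP solution. -/
  | branch (N : D.Node) (rest : Multiset D.Node) (inc : Option (Point n l)) (p : Point n l)
      (hp : D.IsLPSolution N p) (hinc : ∀ s, inc = some s → P.value p ≤ P.value s)
      (hy : ¬ ∀ j, ∃ z : ℤ, p.2 j = (z : ℝ))
      (q : Fin k) (v : D.BlockPoint q) (hv : D.IsSubSolution N p q v)
      (hlt : D.blockValue q (D.restrict q p) < D.blockValue q v) :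
      Step Δ ⟨N ::ₘ rest, inc⟩
        ⟨D.objChild Δ N q (D.blockValue q v) ::ₘ (D.linkChildren Δ N p q + rest), inc⟩
  /-- Branching on a block whose subproblem is infeasible: there is no child node for the objective
  function. -/
  | branchInfeasible (N : D.Node) (rest : Multiset D.Node) (inc : Option (Point n l))
      (p : Point n l)
      (hp : D.IsLPSolution N p) (hinc : ∀ s, inc = some s → P.value p ≤ P.value s)
      (hy : ¬ ∀ j, ∃ z : ℤ, p.2 j = (z : ℝ))
      (q : Fin k) (hq : D.SubInfeasible N p q) :
      Step Δ ⟨N ::ₘ rest, inc⟩ ⟨D.linkChildren Δ N p q + rest, inc⟩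

/-- `RunsTo Δ t s`: some run of the algorithm is in state `s` after `t` iterations. -/
inductive RunsTo (Δ : ℕ) : ℕ → D.State → Prop
  | start : RunsTo Δ 0 D.init
  | next (t : ℕ) (s s' : D.State) (hs : RunsTo Δ t s) (hstep : D.Step Δ s s') :
      RunsTo Δ (t + 1) s'

end Decomposition

end DecBranch

/-! Exactness. Fix the integral part y of an optimal solution. The x that remain optimal for this y
form a compact set. An extreme point of it is determined by its tight inequalities, and g - By is
integral, so Δ-regularity puts this point in (1/Δ)ℤⁿ (`exists_isOptimal_delta`). At such a
Δ-integral point every block row and every block objective is a multiple of 1/Δ, so branching with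
rounded right-hand sides keeps it. Either some linking row of the branching block lies strictly
below its LP value, which gives a link child, or the block is feasible for the subproblem and costs
at least z*, which gives the objective child. Hence the point stays in a pending node until the
incumbent is at least as good (`Step.covers`). Mixed-integer points that are not Δ-integral may be
lost.

Feasibility of candidates rests on an exchange argument: subproblem solutions never lower a linking
row, so replacing blocks of an LP solution by them preserves the node LP (`combine_mem_nodeLP`).

Termination. Right-hand sides are ceilings, rescaled, of continuous functions on a compact set, so
only finitely many cuts can occur (`finite_cuts`). The LP solution of a node satisfies its cuts but
violates each new one, so no cut repeats along a path. Depth is thus bounded by the number of cuts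
and branching by m + 1, and a weighted count of pending nodes decreases (`Step.potential_lt`). -/

namespace DecBranch

open Matrix

/-! ### Basic solutions and Δ-regularity -/

/-- A matrix with trivial kernel has a non-singular square submatrix made of all columns. -/
theorem exists_rows_det_ne_zero {K I J : Type*} [Field K] [Finite I] [Fintype J] [DecidableEq J]
    (M : Matrix I J K) (h : ∀ w, M *ᵥ w = 0 → w = 0) :
    ∃ r : J → I, Function.Injective r ∧ (M.submatrix r id).det ≠ 0 := by
  classical
  have := Fintype.ofFinite I
  obtain ⟨κ, a, ha, hspan, hli⟩ := exists_linearIndependent' K M.row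
  have := Finite.of_injective a ha
  have := Fintype.ofFinite κ
  have hcols : LinearIndependent K Mᵀ.row :=
    Matrix.mulVec_injective_iff.mp ((injective_iff_map_eq_zero M.mulVecLin).2 h)
  -- A maximal independent family of rows has as many members as there are columns, since row rank
  -- equals column rank and the columns are independent.
  have hcard : Fintype.card κ = Fintype.card J := by
    rw [← hcols.rank_matrix, Matrix.rank_transpose, Matrix.rank_eq_finrank_span_row, ← hspan,
      finrank_span_eq_card hli]
  let e : J ≃ κ := Fintype.equivOfCardEq hcard.symm
  refine ⟨a ∘ e, ha.comp e.injective, ?_⟩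
  have hrows : LinearIndependent K (M.submatrix (a ∘ e) id).row := hli.comp e e.injective
  rw [Matrix.linearIndependent_rows_iff_isUnit, Matrix.isUnit_iff_isUnit_det] at hrows
  exact hrows.ne_zero

/-- A basic solution of `A x ≥ b`, `x ≥ 0` (the tight inequalities determine it) lies in
`(1/Δ)ℤⁿ` if `A` is `Δ`-regular. -/
theorem IsDeltaRegular.integral_of_basic {m n Δ : ℕ} {A : Matrix (Fin m) (Fin n) ℤ}
    (hreg : IsDeltaRegular Δ (A.map (Int.cast : ℤ → ℚ))) (b : Fin m → ℤ) (x : Fin n → ℝ)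
    (hx : ∀ w : Fin n → ℝ, (∀ j, x j = 0 → w j = 0) →
      (∀ i, ∑ j, (A i j : ℝ) * x j = b i → ∑ j, (A i j : ℝ) * w j = 0) → w = 0) (j : Fin n) :
    ∃ z : ℤ, (Δ : ℝ) * x j = z := by
  classical
  by_cases hj : x j = 0
  · exact ⟨0, by simp [hj]⟩
  -- Only the support of `x` and the tight rows matter: the columns in `S`, restricted to the rows
  -- in `T`, have trivial kernel by `hx`.
  let S : Type := {j : Fin n // x j ≠ 0}
  let T : Type := {i : Fin m // ∑ j, (A i j : ℝ) * x j = b i}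
  let e : Fin (Fintype.card S) ≃ S := (Fintype.equivFin S).symm
  have hsupp (i : Fin m) (w : Fin n → ℝ) (hw : ∀ j, x j = 0 → w j = 0) :
      ∑ t, (A i (e t).1 : ℝ) * w (e t).1 = ∑ j, (A i j : ℝ) * w j := by
    rw [e.sum_comp (fun s : S => (A i s.1 : ℝ) * w s.1),
      ← Finset.sum_subtype (Finset.univ.filter fun j => x j ≠ 0) (by simp)
        (fun j => (A i j : ℝ) * w j)]
    refine Finset.sum_subset (Finset.subset_univ _) fun j _ hj => ?_
    rw [hw j (by simpa using hj), mul_zero]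
  let M : Matrix T (Fin (Fintype.card S)) ℝ := Matrix.of fun i t => (A i.1 (e t).1 : ℝ)
  obtain ⟨r, hr, hdet⟩ := exists_rows_det_ne_zero M (by
    intro w hw
    -- Extension by zero turns a kernel vector on the support into a direction to which `hx`
    -- applies.
    let w' : Fin n → ℝ := fun j => if h : x j ≠ 0 then w (e.symm ⟨j, h⟩) else 0
    have hw' (t) : w' (e t).1 = w t := by
      have := (e t).2
      simp [w', this]
    have h0 : w' = 0 := by
      refine hx w' (fun j hj => by simp [w', hj]) fun i hi => ?_
      rw [← hsupp i w' (fun j hj => by simp [w', hj])]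
      simp only [hw']
      exact congrFun hw ⟨i, hi⟩
    ext t
    rw [← hw' t, h0]; rfl)
  let r' : Fin (Fintype.card S) ↪ Fin m := ⟨fun t => (r t).1, Subtype.val_injective.comp hr⟩
  let s' : Fin (Fintype.card S) ↪ Fin n := ⟨fun t => (e t).1, Subtype.val_injective.comp e.injective⟩
  let R : Matrix _ _ ℚ := (A.map (Int.cast : ℤ → ℚ)).submatrix r' s'
  have hR : R.map (Rat.castHom ℝ) = M.submatrix r id := by
    ext a c
    simp [R, M, r', s']
  have hRdet : R.det ≠ 0 := by
    intro h
    rw [← hR, ← RingHom.mapMatrix_apply, ← RingHom.map_det, h] at hdet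
    simp at hdet
  have hinv : (R⁻¹).map (Rat.castHom ℝ) * M.submatrix r id = 1 := by
    rw [← hR, ← Matrix.map_mul, Matrix.nonsing_inv_mul _ (isUnit_iff_ne_zero.2 hRdet)]
    simp
  have hMx : M.submatrix r id *ᵥ (fun t => x (e t).1) = fun t => (b (r t).1 : ℝ) := by
    ext t
    rw [← (r t).2, ← hsupp _ x (fun _ h => h)]
    rfl
  have hxe : (fun t => x (e t).1) = (R⁻¹).map (Rat.castHom ℝ) *ᵥ fun t => (b (r t).1 : ℝ) := by
    rw [← hMx, Matrix.mulVec_mulVec, hinv, Matrix.one_mulVec]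
  have hxj := congrFun hxe (e.symm ⟨j, hj⟩)
  simp only [Equiv.apply_symm_apply] at hxj
  choose Z hZ using hreg _ r' s' hRdet
  -- On the support x = R⁻¹b, and `Z` is the integral matrix ΔR⁻¹.
  refine ⟨∑ t, Z (e.symm ⟨j, hj⟩) t * b (r t).1, ?_⟩
  rw [hxj, Matrix.mulVec, dotProduct, Finset.mul_sum]
  push_cast
  refine Finset.sum_congr rfl fun t _ => ?_
  rw [← mul_assoc]
  congr 1
  have := congrArg (Rat.cast : ℚ → ℝ) (hZ (e.symm ⟨j, hj⟩) t)
  push_cast at this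
  exact this

theorem isClosed_integral {ι : Type*} : IsClosed {f : ι → ℝ | ∀ j, ∃ z : ℤ, f j = (z : ℝ)} := by
  have h : {f : ι → ℝ | ∀ j, ∃ z : ℤ, f j = (z : ℝ)} =
      Set.univ.pi fun _ => Set.range ((↑) : ℤ → ℝ) := by
    ext f
    simp [eq_comm]
  rw [h]
  exact isClosed_set_pi fun _ _ => Int.isClosedEmbedding_coe_real.isClosed_range

/-! ### Compactness and a Δ-integral optimal solution -/

namespace MIP

variable {m n l : ℕ} (P : MIP m n l)

theorem continuous_value : Continuous P.value := by
  unfold value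
  fun_prop

theorem isClosed_lpFeasible : IsClosed P.lpFeasible := by
  simp only [lpFeasible, Set.ofPred_and, Set.ofPred_forall]
  refine (isClosed_iInter fun i => isClosed_le (by fun_prop) (by fun_prop)).inter
    ((isClosed_iInter fun j => isClosed_le (by fun_prop) (by fun_prop)).inter
    (isClosed_iInter fun j => isClosed_le (by fun_prop) (by fun_prop)))

theorem isCompact_lpFeasible (h : Bornology.IsBounded P.lpFeasible) : IsCompact P.lpFeasible :=
  Metric.isCompact_of_isClosed_isBounded P.isClosed_lpFeasible h

theorem isCompact_feasible (h : Bornology.IsBounded P.lpFeasible) : IsCompact P.feasible :=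
  (P.isCompact_lpFeasible h).inter_right (isClosed_integral.preimage continuous_snd)

/-- If the problem is feasible, some optimal solution has `x ∈ (1/Δ)ℤⁿ`. -/
theorem exists_isOptimal_delta {Δ : ℕ}
    (hreg : IsDeltaRegular Δ (P.A.map (Int.cast : ℤ → ℚ)))
    (hbdd : Bornology.IsBounded P.lpFeasible) (hne : P.feasible.Nonempty) :
    ∃ p, P.IsOptimal p ∧ ∀ j, ∃ z : ℤ, (Δ : ℝ) * p.1 j = z := by
  obtain ⟨p₀, hp₀, hmin⟩ := (P.isCompact_feasible hbdd).exists_isMinOn hne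
    P.continuous_value.continuousOn
  choose y hy using hp₀.2
  -- The optimal x for the fixed integral y of `p₀`; being compact and nonempty, it has an extreme
  -- point.
  let F : Set (Fin n → ℝ) := {x | (x, p₀.2) ∈ P.feasible ∧ P.value (x, p₀.2) ≤ P.value p₀}
  have hclosed : IsClosed F :=
    ((P.isCompact_feasible hbdd).isClosed.preimage (by fun_prop : Continuous fun x => (x, p₀.2))).inter
      (isClosed_le (P.continuous_value.comp (by fun_prop)) continuous_const)
  have hF : IsCompact F :=
    ((hbdd.image_fst).isCompact_closure).of_isClosed_subset hclosed
      fun x hx => subset_closure ⟨_, hx.1.1, rfl⟩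
  obtain ⟨x, hx⟩ := hF.extremePoints_nonempty ⟨p₀.1, hp₀, le_rfl⟩
  have hxF : x ∈ F := hx.1
  refine ⟨(x, p₀.2), ⟨hxF.1, fun p' hp' => hxF.2.trans (hmin hp')⟩, fun j => ?_⟩
  refine hreg.integral_of_basic (fun i => P.g i - ∑ j, P.B i j * y j) x ?_ j
  intro w hw hA
  -- small steps in the directions `w` and `-w` stay feasible
  have key : ∃ ε > (0 : ℝ), ∀ s : ℝ, |s| ≤ ε → (x + s • w, p₀.2) ∈ P.lpFeasible := by
    have hev : ∀ᶠ s in nhds (0 : ℝ), (x + s • w, p₀.2) ∈ P.lpFeasible := by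
      have h1 : ∀ᶠ s in nhds (0 : ℝ), ∀ i, (P.g i : ℝ) ≤
          ∑ j, (P.A i j : ℝ) * (x + s • w) j + ∑ j, (P.B i j : ℝ) * p₀.2 j := by
        refine Filter.eventually_all.2 fun i => ?_
        rcases (hxF.1.1.1 i).eq_or_lt with h | h
        -- A tight row is constant along `w`; a slack row stays satisfied near 0 by continuity. The
        -- sign constraints are treated alike.
        · have hAw := hA i (by push_cast; simp only [← hy]; simp only at h; linarith)
          refine Filter.Eventually.of_forall fun s => ?_
          have : ∑ j, (P.A i j : ℝ) * (x + s • w) j = ∑ j, (P.A i j : ℝ) * x j := by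
            simp only [Pi.add_apply, Pi.smul_apply, smul_eq_mul, mul_add, Finset.sum_add_distrib,
              mul_left_comm _ s, ← Finset.mul_sum, hAw, mul_zero, add_zero]
          rw [this]
          exact h.le
        · have hc : Continuous fun s : ℝ =>
            ∑ j, (P.A i j : ℝ) * (x + s • w) j + ∑ j, (P.B i j : ℝ) * p₀.2 j := by fun_prop
          have := (hc.tendsto 0).eventually (lt_mem_nhds (a := (P.g i : ℝ)) (by simpa using h))
          exact this.mono fun s hs => le_of_lt hs
      have h2 : ∀ᶠ s in nhds (0 : ℝ), ∀ j, 0 ≤ (x + s • w) j := by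
        refine Filter.eventually_all.2 fun j => ?_
        rcases (hxF.1.1.2.1 j).eq_or_lt with h | h
        · have hwj := hw j h.symm
          exact Filter.Eventually.of_forall fun s => by simpa [hwj] using h.le
        · have hc : Continuous fun s : ℝ => (x + s • w) j := by fun_prop
          have := (hc.tendsto 0).eventually (lt_mem_nhds (a := (0 : ℝ)) (by simpa using h))
          exact this.mono fun s hs => le_of_lt hs
      filter_upwards [h1, h2] with s hs1 hs2 using ⟨hs1, hs2, hp₀.1.2.2⟩
    obtain ⟨ε, hε, hball⟩ := Metric.eventually_nhds_iff.1 hev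
    refine ⟨ε / 2, by positivity, fun s hs => hball ?_⟩
    rw [Real.dist_eq, sub_zero]
    linarith
  obtain ⟨ε, hε, hfeas⟩ := key
  have hval (s : ℝ) : P.value (x + s • w, p₀.2) =
      P.value (x, p₀.2) + s * ∑ j, (P.c j : ℝ) * w j := by
    simp only [value, Pi.add_apply, Pi.smul_apply, smul_eq_mul, mul_add, Finset.sum_add_distrib,
      mul_left_comm _ s, ← Finset.mul_sum]
    ring
  have hplus : (x + ε • w, p₀.2) ∈ P.feasible :=
    ⟨hfeas ε (abs_of_pos hε).le, hp₀.2⟩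
  have hminus : (x + (-ε) • w, p₀.2) ∈ P.feasible :=
    ⟨hfeas (-ε) (by rw [abs_neg, abs_of_pos hε]), hp₀.2⟩
  have h1 := hmin hplus
  have h2 := hmin hminus
  simp only [Set.mem_ofPred_eq, hval] at h1 h2
  have h3 := hxF.2
  have hseg : x ∈ openSegment ℝ (x + ε • w) (x + (-ε) • w) :=
    ⟨1 / 2, 1 / 2, by norm_num, by norm_num, by norm_num, by ext j; simp; ring⟩
  -- Optimality in both directions forces zero objective change along `w`, so both endpoints lie in
  -- `F`, and extremality of their midpoint `x` gives w = 0.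
  have heq := (mem_extremePoints.1 hx).2 (x + ε • w) ⟨hplus, by rw [hval]; linarith⟩
    (x + (-ε) • w) ⟨hminus, by rw [hval]; linarith⟩ hseg
  have := heq.1
  simpa [hε.ne'] using this

end MIP

/-! ### Block structure and exchange of blocks -/

namespace Decomposition

variable {m n l k : ℕ} {P : MIP m n l} (D : Decomposition P k)

@[simp] theorem restrict_combine (v : ∀ q, D.BlockPoint q) (q : Fin k) :
    D.restrict q (D.combine v) = v q := by
  refine Prod.ext (funext ?_) (funext ?_) <;> rintro ⟨j, rfl⟩ <;> rfl

theorem sum_blockRow_restrict (p : Point n l) (i : Fin m) :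
    ∑ q, D.blockRow q i (D.restrict q p) =
      ∑ j, (P.A i j : ℝ) * p.1 j + ∑ j, (P.B i j : ℝ) * p.2 j := by
  simp only [blockRow, restrict, Finset.sum_add_distrib]
  rw [Fintype.sum_fiberwise D.colX fun j => (P.A i j : ℝ) * p.1 j,
    Fintype.sum_fiberwise D.colY fun j => (P.B i j : ℝ) * p.2 j]

theorem sum_blockValue_restrict (p : Point n l) :
    ∑ q, D.blockValue q (D.restrict q p) = P.value p := by
  simp only [blockValue, restrict, Finset.sum_add_distrib, MIP.value]
  rw [Fintype.sum_fiberwise D.colX fun j => (P.c j : ℝ) * p.1 j,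
    Fintype.sum_fiberwise D.colY fun j => (P.d j : ℝ) * p.2 j]

theorem value_combine (v : ∀ q, D.BlockPoint q) :
    P.value (D.combine v) = ∑ q, D.blockValue q (v q) := by
  simp [← D.sum_blockValue_restrict]

theorem blockRow_eq_zero {q q' : Fin k} {i : Fin m} (h : D.row i = some q) (hq : q' ≠ q)
    (v : D.BlockPoint q') : D.blockRow q' i v = 0 := by
  have hA (j : {j // D.colX j = q'}) : P.A i j.1 = 0 :=
    D.A_eq_zero i j.1 q h (by rw [j.2]; exact hq)
  have hB (j : {j // D.colY j = q'}) : P.B i j.1 = 0 :=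
    D.B_eq_zero i j.1 q h (by rw [j.2]; exact hq)
  simp [blockRow, hA, hB]

theorem blockRow_restrict_of_row {q : Fin k} {i : Fin m} (h : D.row i = some q) (p : Point n l) :
    D.blockRow q i (D.restrict q p) =
      ∑ j, (P.A i j : ℝ) * p.1 j + ∑ j, (P.B i j : ℝ) * p.2 j := by
  rw [← D.sum_blockRow_restrict, Finset.sum_eq_single q]
  · exact fun q' _ hq' => D.blockRow_eq_zero h hq' _
  · simp

theorem continuous_restrict (q : Fin k) : Continuous (D.restrict q) := by
  unfold restrict
  fun_prop

theorem continuous_blockRow (q : Fin k) (i : Fin m) : Continuous (D.blockRow q i) := by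
  unfold blockRow
  fun_prop

theorem continuous_blockValue (q : Fin k) : Continuous (D.blockValue q) := by
  unfold blockValue
  fun_prop

theorem isClosed_cutHolds (q : Fin k) (b : D.Cut) : IsClosed {v | D.CutHolds q v b} := by
  cases b with
  | link j rhs => exact isClosed_le (D.continuous_blockRow q j.1) continuous_const
  | obj rhs => exact isClosed_le continuous_const (D.continuous_blockValue q)

theorem isClosed_nodeLP (N : D.Node) : IsClosed (D.nodeLP N) := by
  have h : D.nodeLP N = P.lpFeasible ∩
      ⋂ e ∈ N, D.restrict e.1 ⁻¹' {v | D.CutHolds e.1 v e.2} := by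
    ext p
    simp [nodeLP]
  rw [h]
  exact P.isClosed_lpFeasible.inter (isClosed_biInter fun e _ =>
    (D.isClosed_cutHolds e.1 e.2).preimage (D.continuous_restrict e.1))

theorem exists_isLPSolution (hbdd : Bornology.IsBounded P.lpFeasible) {N : D.Node}
    (hN : (D.nodeLP N).Nonempty) : ∃ p, D.IsLPSolution N p := by
  have hc : IsCompact (D.nodeLP N) :=
    (P.isCompact_lpFeasible hbdd).of_isClosed_subset (D.isClosed_nodeLP N) fun _ hp => hp.1
  obtain ⟨p, hp, hmin⟩ := hc.exists_isMinOn hN P.continuous_value.continuousOn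
  exact ⟨p, hp, fun p' hp' => hmin hp'⟩

/-- Blocks of a point of the node LP may be exchanged for points of their subproblems. -/
theorem combine_mem_nodeLP {N : D.Node} {p : Point n l} (hp : p ∈ D.nodeLP N)
    {v : ∀ q, D.BlockPoint q} (hv : ∀ q, v q = D.restrict q p ∨ v q ∈ D.subFeasible N p q) :
    D.combine v ∈ D.nodeLP N := by
  have hlink (q) (i : D.LinkRow) : D.blockRow q i.1 (D.restrict q p) ≤ D.blockRow q i.1 (v q) := by
    rcases hv q with h | h
    · rw [h]
    · exact h.2.2.1 i
  have hrow (q) (i) (hi : D.row i = some q) : (P.g i : ℝ) ≤ D.blockRow q i (v q) := by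
    rcases hv q with h | h
    · rw [h, D.blockRow_restrict_of_row hi]
      exact hp.1.1 i
    · exact h.1 i hi
  have hx (q) (j) : 0 ≤ (v q).1 j := by
    rcases hv q with h | h
    · rw [h]
      exact hp.1.2.1 j.1
    · exact h.2.2.2.1 j
  have hy (q) (j) : 0 ≤ (v q).2 j := by
    rcases hv q with h | h
    · rw [h]
      exact hp.1.2.2 j.1
    · exact h.2.2.2.2.1 j
  refine ⟨⟨fun i => ?_, fun j => hx _ _, fun j => hy _ _⟩, fun e he => ?_⟩
  · cases hi : D.row i with
    | none =>
      rw [← D.sum_blockRow_restrict]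
      simp only [restrict_combine]
      -- A linking row is the sum of its block contributions, none of which has decreased.
      refine le_trans ?_ (Finset.sum_le_sum fun q _ => hlink q ⟨i, hi⟩)
      rw [D.sum_blockRow_restrict]
      exact hp.1.1 i
    | some q =>
      rw [← D.blockRow_restrict_of_row hi, restrict_combine]
      exact hrow q i hi
  · rw [restrict_combine]
    rcases hv e.1 with h | h
    · rw [h]
      exact hp.2 e he
    · exact h.2.1 e.2 he

/-- The point obtained from `p` by exchanging block `q` for `v`. -/
noncomputable def exchange (p : Point n l) (q : Fin k) (v : D.BlockPoint q) : Point n l :=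
  D.combine (Function.update (fun q' => D.restrict q' p) q v)

@[simp] theorem restrict_exchange (p : Point n l) (q : Fin k) (v : D.BlockPoint q) :
    D.restrict q (D.exchange p q v) = v := by
  simp [exchange]

theorem exchange_mem_nodeLP {N : D.Node} {p : Point n l} (hp : p ∈ D.nodeLP N) {q : Fin k}
    {v : D.BlockPoint q} (hv : v ∈ D.subFeasible N p q) : D.exchange p q v ∈ D.nodeLP N := by
  refine D.combine_mem_nodeLP hp fun q' => ?_
  rcases eq_or_ne q' q with rfl | h
  · exact Or.inr (by simpa using hv)
  · exact Or.inl (by simp [h])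

theorem value_exchange (p : Point n l) (q : Fin k) (v : D.BlockPoint q) :
    P.value (D.exchange p q v) =
      P.value p + (D.blockValue q v - D.blockValue q (D.restrict q p)) := by
  rw [exchange, value_combine, ← D.sum_blockValue_restrict p,
    ← Finset.add_sum_erase _ _ (Finset.mem_univ q), Function.update_self,
    ← Finset.add_sum_erase _ (fun q => D.blockValue q (D.restrict q p)) (Finset.mem_univ q)]
  rw [Finset.sum_congr rfl fun q' hq' => by rw [Function.update_of_ne (Finset.ne_of_mem_erase hq')]]
  ring

/-- A cheaper block could be exchanged into the LP solution and would improve it. -/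
theorem IsLPSolution.blockValue_le {D : Decomposition P k} {N : D.Node} {p : Point n l}
    (hp : D.IsLPSolution N p) {q : Fin k} {v : D.BlockPoint q} (hv : v ∈ D.subFeasible N p q) :
    D.blockValue q (D.restrict q p) ≤ D.blockValue q v := by
  have := hp.2 _ (D.exchange_mem_nodeLP hp.1 hv)
  rw [value_exchange] at this
  linarith

/-! ### Solvability of the subproblems and progress -/

theorem isClosed_subFeasible (N : D.Node) (p : Point n l) (q : Fin k) :
    IsClosed (D.subFeasible N p q) := by
  have h : D.subFeasible N p q =
      (⋂ i, ⋂ _ : D.row i = some q, {v | (P.g i : ℝ) ≤ D.blockRow q i v}) ∩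
      ((⋂ b, ⋂ _ : (q, b) ∈ N, {v | D.CutHolds q v b}) ∩
      ((⋂ i : D.LinkRow, {v | D.blockRow q i.1 (D.restrict q p) ≤ D.blockRow q i.1 v}) ∩
      ((⋂ j, {v | 0 ≤ v.1 j}) ∩ ((⋂ j, {v | 0 ≤ v.2 j}) ∩
      Prod.snd ⁻¹' {f | ∀ j, ∃ z : ℤ, f j = (z : ℝ)})))) := by
    ext v
    simp [subFeasible, IntegralBlock]
  rw [h]
  have hr (i) := D.continuous_blockRow q i
  refine IsClosed.inter ?_ (IsClosed.inter ?_ (IsClosed.inter ?_ (IsClosed.inter ?_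
    (IsClosed.inter ?_ ?_))))
  · exact isClosed_iInter fun i => isClosed_iInter fun _ => isClosed_le continuous_const (hr i)
  · exact isClosed_iInter fun b => isClosed_iInter fun _ => D.isClosed_cutHolds q b
  · exact isClosed_iInter fun i => isClosed_le continuous_const (hr i.1)
  · exact isClosed_iInter fun j => isClosed_le continuous_const (by fun_prop)
  · exact isClosed_iInter fun j => isClosed_le continuous_const (by fun_prop)
  · exact isClosed_integral.preimage continuous_snd

/-- By exchange, the feasible set of a subproblem lies in the projection of the LP polytope to the
block, so it is compact and a minimum is attained whenever it is nonempty. -/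
theorem exists_isSubSolution (hbdd : Bornology.IsBounded P.lpFeasible) {N : D.Node}
    {p : Point n l} (hp : p ∈ D.nodeLP N) (q : Fin k) :
    D.SubInfeasible N p q ∨ ∃ v, D.IsSubSolution N p q v := by
  by_cases hint : D.IntegralBlock q (D.restrict q p)
  · exact Or.inr ⟨_, Or.inl ⟨hint, rfl⟩⟩
  rcases (D.subFeasible N p q).eq_empty_or_nonempty with h | h
  · exact Or.inl ⟨hint, h⟩
  have hc : IsCompact (D.subFeasible N p q) :=
    ((P.isCompact_lpFeasible hbdd).image (D.continuous_restrict q)).of_isClosed_subset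
      (D.isClosed_subFeasible N p q)
      fun v hv => ⟨_, (D.exchange_mem_nodeLP hp hv).1, D.restrict_exchange p q v⟩
  obtain ⟨v, hv, hmin⟩ := hc.exists_isMinOn h (D.continuous_blockValue q).continuousOn
  exact Or.inr ⟨v, Or.inr ⟨hint, hv, fun v' hv' => hmin hv'⟩⟩

/-- As long as a node is pending, an iteration is possible. -/
theorem exists_step (hbdd : Bornology.IsBounded P.lpFeasible) (Δ : ℕ) {s : D.State}
    (hs : s.pending ≠ 0) : ∃ s', D.Step Δ s s' := by
  obtain ⟨pending, inc⟩ := s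
  obtain ⟨N, hN⟩ := Multiset.exists_mem_of_ne_zero hs
  obtain ⟨rest, rfl⟩ := Multiset.exists_cons_of_mem hN
  rcases (D.nodeLP N).eq_empty_or_nonempty with hempty | hne
  · exact ⟨_, .infeasible N rest inc hempty⟩
  obtain ⟨p, hp⟩ := D.exists_isLPSolution hbdd hne
  by_cases hinc : ∀ s, inc = some s → P.value p ≤ P.value s
  swap
  · push Not at hinc
    obtain ⟨s, rfl, hlt⟩ := hinc
    exact ⟨_, .bound N rest s p hp hlt.le⟩
  by_cases hy : ∀ j, ∃ z : ℤ, p.2 j = (z : ℝ)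
  · exact ⟨_, .integral N rest inc p hp hinc hy⟩
  by_cases hinf : ∃ q, D.SubInfeasible N p q
  · obtain ⟨q, hq⟩ := hinf
    exact ⟨_, .branchInfeasible N rest inc p hp hinc hy q hq⟩
  push Not at hinf
  choose v hv using fun q => (D.exists_isSubSolution hbdd hp.1 q).resolve_left (hinf q)
  by_cases heq : ∀ q, D.blockValue q (v q) = D.blockValue q (D.restrict q p)
  · exact ⟨_, .blocks N rest inc p hp hinc hy v hv heq⟩
  push Not at heq
  obtain ⟨q, hq⟩ := heq
  have hle : D.blockValue q (D.restrict q p) ≤ D.blockValue q (v q) := by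
    rcases hv q with h | h
    · rw [h.2]
    · exact hp.blockValue_le h.2.1
  exact ⟨_, .branch N rest inc p hp hinc hy q (v q) (hv q) (lt_of_le_of_ne hle hq.symm)⟩

/-! ### Exactness: Δ-integral points are not lost -/

theorem exists_int_sum {ι : Type*} [Fintype ι] (r : ℝ) (a : ι → ℤ) (f : ι → ℝ)
    (h : ∀ j, ∃ z : ℤ, r * f j = z) : ∃ z : ℤ, r * ∑ j, (a j : ℝ) * f j = z := by
  choose z hz using h
  refine ⟨∑ j, a j * z j, ?_⟩
  push_cast
  rw [Finset.mul_sum]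
  exact Finset.sum_congr rfl fun j _ => by rw [← hz, mul_left_comm]

/-- A point with `x ∈ (1/Δ)ℤⁿ` and integral `y`. -/
def IsDeltaIntegral (Δ : ℕ) (p : Point n l) : Prop :=
  (∀ j, ∃ z : ℤ, (Δ : ℝ) * p.1 j = z) ∧ ∀ j, ∃ z : ℤ, p.2 j = (z : ℝ)

theorem IsDeltaIntegral.snd {Δ : ℕ} {p : Point n l} (hp : IsDeltaIntegral Δ p) (j : Fin l) :
    ∃ z : ℤ, (Δ : ℝ) * p.2 j = z := by
  obtain ⟨z, hz⟩ := hp.2 j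
  exact ⟨Δ * z, by rw [hz]; push_cast; rfl⟩

theorem IsDeltaIntegral.blockRow {Δ : ℕ} {p : Point n l} (hp : IsDeltaIntegral Δ p) (q : Fin k)
    (i : Fin m) : ∃ z : ℤ, (Δ : ℝ) * D.blockRow q i (D.restrict q p) = z := by
  obtain ⟨z₁, h₁⟩ := exists_int_sum Δ (fun j : {j // D.colX j = q} => P.A i j.1)
    (fun j => p.1 j.1) fun j => hp.1 j.1
  obtain ⟨z₂, h₂⟩ := exists_int_sum Δ (fun j : {j // D.colY j = q} => P.B i j.1)
    (fun j => p.2 j.1) fun j => hp.snd j.1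
  exact ⟨z₁ + z₂, by rw [Int.cast_add, ← h₁, ← h₂, ← mul_add]; rfl⟩

theorem IsDeltaIntegral.blockValue {Δ : ℕ} {p : Point n l} (hp : IsDeltaIntegral Δ p)
    (q : Fin k) : ∃ z : ℤ, (Δ : ℝ) * D.blockValue q (D.restrict q p) = z := by
  obtain ⟨z₁, h₁⟩ := exists_int_sum Δ (fun j : {j // D.colX j = q} => P.c j.1)
    (fun j => p.1 j.1) fun j => hp.1 j.1
  obtain ⟨z₂, h₂⟩ := exists_int_sum Δ (fun j : {j // D.colY j = q} => P.d j.1)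
    (fun j => p.2 j.1) fun j => hp.snd j.1
  exact ⟨z₁ + z₂, by rw [Int.cast_add, ← h₁, ← h₂, ← mul_add]; rfl⟩

theorem mem_nodeLP_cons {e : Fin k × D.Cut} {N : D.Node} {p : Point n l} :
    p ∈ D.nodeLP (e :: N) ↔ p ∈ D.nodeLP N ∧ D.CutHolds e.1 (D.restrict e.1 p) e.2 := by
  simp [nodeLP]
  tauto

/-- A `Δ`-integral point of a node either lies in a child for a linking row, or its block `q` is
feasible for the subproblem. -/
theorem mem_linkChildren_or_mem_subFeasible {Δ : ℕ} (hΔ : 0 < Δ) {N : D.Node} {p x : Point n l}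
    (hx : x ∈ D.nodeLP N) (hint : IsDeltaIntegral Δ x) (q : Fin k) :
    (∃ N' ∈ D.linkChildren Δ N p q, x ∈ D.nodeLP N') ∨
      D.restrict q x ∈ D.subFeasible N p q := by
  have hΔ' : (0 : ℝ) < Δ := by exact_mod_cast hΔ
  by_cases h : ∀ i : D.LinkRow,
      D.blockRow q i.1 (D.restrict q p) ≤ D.blockRow q i.1 (D.restrict q x)
  · refine Or.inr ⟨fun i hi => ?_, fun b hb => hx.2 _ hb, h, fun j => hx.1.2.1 _,
      fun j => hx.1.2.2 _, fun j => hint.2 j.1⟩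
    rw [D.blockRow_restrict_of_row hi]
    exact hx.1.1 i
  · push Not at h
    obtain ⟨i, hi⟩ := h
    refine Or.inl ⟨_, Multiset.mem_map_of_mem _ (Finset.mem_univ_val i), ?_⟩
    refine D.mem_nodeLP_cons.2 ⟨hx, ?_⟩
    obtain ⟨z, hz⟩ := hint.blockRow D q i.1
    change _ ≤ _
    rw [le_div_iff₀ hΔ', mul_comm, hz, le_sub_iff_add_le]
    -- The integer `z` lies strictly below the scaled LP value, hence is at most its ceiling minus
    -- one; this is why the right-hand side may be lowered so far.
    have : z < ⌈(Δ : ℝ) * D.blockRow q i.1 (D.restrict q p)⌉ := by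
      rw [Int.lt_ceil, ← hz]
      exact mul_lt_mul_of_pos_left hi hΔ'
    exact_mod_cast this

theorem mem_objChild {Δ : ℕ} (hΔ : 0 < Δ) {N : D.Node} {x : Point n l}
    (hx : x ∈ D.nodeLP N) (hint : IsDeltaIntegral Δ x) {q : Fin k} {z : ℝ}
    (hz : z ≤ D.blockValue q (D.restrict q x)) : x ∈ D.nodeLP (D.objChild Δ N q z) := by
  have hΔ' : (0 : ℝ) < Δ := by exact_mod_cast hΔ
  refine D.mem_nodeLP_cons.2 ⟨hx, ?_⟩
  obtain ⟨t, ht⟩ := hint.blockValue D q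
  change (_ : ℝ) / _ ≤ D.blockValue q (D.restrict q x)
  rw [div_le_iff₀ hΔ', mul_comm (D.blockValue q _), ht, Int.cast_le, Int.ceil_le, ← ht]
  exact mul_le_mul_of_nonneg_left hz hΔ'.le

theorem exists_update (inc : Option (Point n l)) (p : Point n l) :
    ∃ s, update P inc p = some s ∧ (s = p ∨ inc = some s) ∧ P.value s ≤ P.value p ∧
      ∀ s₀, inc = some s₀ → P.value s ≤ P.value s₀ := by
  cases inc with
  | none => exact ⟨p, rfl, Or.inl rfl, le_rfl, by simp⟩
  | some s₀ =>
    by_cases h : P.value p < P.value s₀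
    · exact ⟨p, by simp [update, h], Or.inl rfl, le_rfl, by simpa using h.le⟩
    · exact ⟨s₀, by simp [update, h], Or.inr rfl, not_lt.1 h, by simp⟩

/-- The solutions of the subproblems form a solution of the mixed-integer problem. -/
theorem combine_mem_feasible {N : D.Node} {p : Point n l} (hp : p ∈ D.nodeLP N)
    {v : ∀ q, D.BlockPoint q} (hv : ∀ q, D.IsSubSolution N p q (v q)) :
    D.combine v ∈ P.feasible := by
  refine ⟨(D.combine_mem_nodeLP hp fun q => ?_).1, fun j => ?_⟩
  · exact (hv q).imp And.right fun h => h.2.1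
  · rcases hv (D.colY j) with h | h
    · exact (congrArg (D.IntegralBlock _) h.2).mpr h.1 ⟨j, rfl⟩
    · exact h.2.1.2.2.2.2.2 ⟨j, rfl⟩

theorem Step.incumbent_feasible {D : Decomposition P k} {Δ : ℕ} {s s' : D.State}
    (h : D.Step Δ s s') (hs : ∀ p, s.incumbent = some p → p ∈ P.feasible) (p : Point n l)
    (hp : s'.incumbent = some p) : p ∈ P.feasible := by
  cases h with
  | infeasible | bound | branch | branchInfeasible => exact hs p hp
  | integral N rest inc p' hp' hinc hy =>
    obtain ⟨s, hs', h | h, -⟩ := exists_update (P := P) inc p'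
    all_goals obtain rfl : s = p := Option.some_injective _ (hs'.symm.trans hp)
    · exact h ▸ ⟨hp'.1.1, hy⟩
    · exact hs _ h
  | blocks N rest inc p' hp' hinc hy v hv heq =>
    obtain ⟨s, hs', h | h, -⟩ := exists_update (P := P) inc (D.combine v)
    all_goals obtain rfl : s = p := Option.some_injective _ (hs'.symm.trans hp)
    · exact h ▸ D.combine_mem_feasible hp'.1 hv
    · exact hs _ h

/-- A solution is accounted for: the incumbent is at least as good, or it lies in a pending node. -/
def Covers (s : D.State) (x : Point n l) : Prop :=
  (∃ p, s.incumbent = some p ∧ P.value p ≤ P.value x) ∨ ∃ N ∈ s.pending, x ∈ D.nodeLP N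

theorem Covers.of_cons {D : Decomposition P k} {N : D.Node} {rest C : Multiset D.Node}
    {inc inc' : Option (Point n l)} {x : Point n l} (hs : D.Covers ⟨N ::ₘ rest, inc⟩ x)
    (hinc : ∀ p, inc = some p → ∃ p', inc' = some p' ∧ P.value p' ≤ P.value p)
    (hN : x ∈ D.nodeLP N → D.Covers ⟨C, inc'⟩ x) : D.Covers ⟨C + rest, inc'⟩ x := by
  rcases hs with ⟨p, hp, hle⟩ | ⟨N', hN', hx⟩
  · obtain ⟨p', hp', hle'⟩ := hinc p hp
    exact Or.inl ⟨p', hp', hle'.trans hle⟩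
  · rcases Multiset.mem_cons.1 hN' with rfl | hN'
    · exact (hN hx).imp_right fun ⟨N₁, h₁, h₂⟩ => ⟨N₁, Multiset.mem_add.2 (Or.inl h₁), h₂⟩
    · exact Or.inr ⟨N', Multiset.mem_add.2 (Or.inr hN'), hx⟩

/-- Pruning compares with the LP optimum of the node, a lower bound for the point. Branching keeps
the point by the dichotomy of `mem_linkChildren_or_mem_subFeasible`. -/
theorem Step.covers {D : Decomposition P k} {Δ : ℕ} (hΔ : 0 < Δ) {s s' : D.State}
    (h : D.Step Δ s s') {x : Point n l} (hint : IsDeltaIntegral Δ x) (hs : D.Covers s x) :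
    D.Covers s' x := by
  cases h with
  | infeasible N rest inc hN =>
    rw [← zero_add rest]
    exact hs.of_cons (fun p hp => ⟨p, hp, le_rfl⟩) fun hx => by simp [hN] at hx
  | bound N rest s p hp hle =>
    rw [← zero_add rest]
    exact hs.of_cons (fun p hp => ⟨p, hp, le_rfl⟩) fun hx =>
      Or.inl ⟨s, rfl, hle.trans (hp.2 x hx)⟩
  | integral N rest inc p hp hinc hy =>
    obtain ⟨s, hs', -, h₁, h₂⟩ := exists_update (P := P) inc p
    rw [← zero_add rest]
    exact hs.of_cons (fun p hp => ⟨s, hs', h₂ p hp⟩) fun hx =>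
      Or.inl ⟨s, hs', h₁.trans (hp.2 x hx)⟩
  | blocks N rest inc p hp hinc hy v hv heq =>
    obtain ⟨s, hs', -, h₁, h₂⟩ := exists_update (P := P) inc (D.combine v)
    rw [← zero_add rest]
    refine hs.of_cons (fun p hp => ⟨s, hs', h₂ p hp⟩) fun hx => Or.inl ⟨s, hs', h₁.trans ?_⟩
    -- The candidate has the same value as the LP solution, so it is no worse than any point of the
    -- node.
    rw [value_combine, Finset.sum_congr rfl fun q _ => heq q, sum_blockValue_restrict]
    exact hp.2 x hx
  | branch N rest inc p hp hinc hy q v hv hlt =>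
    rw [← Multiset.cons_add]
    refine hs.of_cons (fun p hp => ⟨p, hp, le_rfl⟩) fun hx => Or.inr ?_
    rcases D.mem_linkChildren_or_mem_subFeasible hΔ hx hint q with ⟨N', hN', hxN'⟩ | hsub
    · exact ⟨N', Multiset.mem_cons_of_mem hN', hxN'⟩
    · refine ⟨D.objChild Δ N q (D.blockValue q v), by simp,
        D.mem_objChild hΔ hx hint ?_⟩
      rcases hv with hv | hv
      · exact absurd hlt (by rw [hv.2]; exact lt_irrefl _)
      · exact hv.2.2 _ hsub
  | branchInfeasible N rest inc p hp hinc hy q hq =>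
    refine hs.of_cons (fun p hp => ⟨p, hp, le_rfl⟩) fun hx => Or.inr ?_
    rcases D.mem_linkChildren_or_mem_subFeasible hΔ hx hint q with h | hsub
    · exact h
    · exact absurd hsub (by simp [hq.2])

theorem RunsTo.incumbent_feasible {D : Decomposition P k} {Δ t : ℕ} {s : D.State}
    (h : D.RunsTo Δ t s) : ∀ p, s.incumbent = some p → p ∈ P.feasible := by
  induction h with
  | start => simp [init]
  | next t s s' _ hstep ih => exact hstep.incumbent_feasible ih

theorem RunsTo.covers {D : Decomposition P k} {Δ t : ℕ} (hΔ : 0 < Δ) {s : D.State}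
    (h : D.RunsTo Δ t s) {x : Point n l} (hx : x ∈ P.lpFeasible) (hint : IsDeltaIntegral Δ x) :
    D.Covers s x := by
  induction h with
  | start => exact Or.inr ⟨[], Multiset.mem_singleton_self _, hx, by simp⟩
  | next t s s' _ hstep ih => exact hstep.covers hΔ hint ih

/-- When no node is pending, the incumbent is an optimal solution, and there is none only if the
problem is infeasible. -/
theorem RunsTo.exactness {D : Decomposition P k} {Δ t : ℕ} (hΔ : 0 < Δ)
    (hreg : IsDeltaRegular Δ (P.A.map (Int.cast : ℤ → ℚ)))
    (hbdd : Bornology.IsBounded P.lpFeasible) {s : D.State} (h : D.RunsTo Δ t s)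
    (hs : s.pending = 0) :
    (∀ p, s.incumbent = some p → P.IsOptimal p) ∧ (s.incumbent = none ↔ P.feasible = ∅) := by
  have key (hne : P.feasible.Nonempty) :
      ∃ p, s.incumbent = some p ∧ ∀ p' ∈ P.feasible, P.value p ≤ P.value p' := by
    obtain ⟨x, hopt, hx⟩ := P.exists_isOptimal_delta hreg hbdd hne
    rcases h.covers hΔ hopt.1.1 ⟨hx, hopt.1.2⟩ with ⟨p, hp, hle⟩ | ⟨N, hN, -⟩
    · exact ⟨p, hp, fun p' hp' => hle.trans (hopt.2 p' hp')⟩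
    · simp [hs] at hN
  refine ⟨fun p hp => ?_, fun hnone => ?_, fun hempty => ?_⟩
  · have hfeas := h.incumbent_feasible p hp
    obtain ⟨p', hp', hmin⟩ := key ⟨p, hfeas⟩
    obtain rfl : p' = p := Option.some_injective _ (hp'.symm.trans hp)
    exact ⟨hfeas, hmin⟩
  · by_contra hne
    obtain ⟨p, hp, -⟩ := key (Set.nonempty_iff_ne_empty.2 hne)
    simp [hnone] at hp
  · by_contra hne
    obtain ⟨p, hp⟩ := Option.ne_none_iff_exists'.1 hne
    simpa [hempty] using h.incumbent_feasible p hp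

end Decomposition
-- Termination: finitely many cuts, bounded depth, decreasing potential
theorem finite_image_ceil {X : Type*} [TopologicalSpace X] {K : Set X} (hK : IsCompact K)
    {f : X → ℝ} (hf : Continuous f) : ((fun x => ⌈f x⌉) '' K).Finite := by
  obtain ⟨a, ha⟩ := (hK.image hf).bddBelow
  obtain ⟨b, hb⟩ := (hK.image hf).bddAbove
  refine (Set.finite_Icc ⌈a⌉ ⌈b⌉).subset ?_
  rintro _ ⟨x, hx, rfl⟩
  exact ⟨Int.ceil_mono (ha ⟨x, hx, rfl⟩), Int.ceil_mono (hb ⟨x, hx, rfl⟩)⟩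

namespace Decomposition

variable {m n l k : ℕ} {P : MIP m n l} (D : Decomposition P k)

/-- The branching inequalities that can be generated at points of the LP relaxation. -/
def cuts (Δ : ℕ) : Set (Fin k × D.Cut) :=
  (⋃ q, ⋃ j : D.LinkRow, (fun z : ℤ => (q, Cut.link j (((z : ℝ) - 1) / (Δ : ℝ)))) ''
      ((fun p => ⌈(Δ : ℝ) * D.blockRow q j.1 (D.restrict q p)⌉) '' P.lpFeasible)) ∪
    ⋃ q, (fun z : ℤ => (q, Cut.obj ((z : ℝ) / (Δ : ℝ)))) ''
      ((fun p => ⌈(Δ : ℝ) * D.blockValue q (D.restrict q p)⌉) '' P.lpFeasible)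

theorem finite_cuts (hbdd : Bornology.IsBounded P.lpFeasible) (Δ : ℕ) : (D.cuts Δ).Finite := by
  have hc := P.isCompact_lpFeasible hbdd
  refine Set.Finite.union (Set.finite_iUnion fun q => Set.finite_iUnion fun j => ?_)
    (Set.finite_iUnion fun q => ?_)
  · exact (finite_image_ceil hc (continuous_const.mul
      ((D.continuous_blockRow q j.1).comp (D.continuous_restrict q)))).image _
  · exact (finite_image_ceil hc (continuous_const.mul
      ((D.continuous_blockValue q).comp (D.continuous_restrict q)))).image _

/-- A node whose branching inequalities are pairwise distinct and taken from `D.cuts Δ`. -/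
def Admissible (Δ : ℕ) (N : D.Node) : Prop :=
  N.Nodup ∧ ∀ e ∈ N, e ∈ D.cuts Δ

theorem Admissible.length_le {D : Decomposition P k} (hbdd : Bornology.IsBounded P.lpFeasible)
    {Δ : ℕ} {N : D.Node} (hN : D.Admissible Δ N) : N.length ≤ (D.cuts Δ).ncard := by
  classical
  rw [← List.toFinset_card_of_nodup hN.1, ← Set.ncard_coe_finset]
  exact Set.ncard_le_ncard (fun e he => hN.2 e (by simpa using he)) (D.finite_cuts hbdd Δ)

/-- A branching inequality that the LP solution violates is new. -/
theorem Admissible.cons {D : Decomposition P k} {Δ : ℕ} {N : D.Node} (hN : D.Admissible Δ N)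
    {p : Point n l} (hp : p ∈ D.nodeLP N) {e : Fin k × D.Cut} (he : e ∈ D.cuts Δ)
    (hpe : ¬ D.CutHolds e.1 (D.restrict e.1 p) e.2) : D.Admissible Δ (e :: N) :=
  ⟨List.nodup_cons.2 ⟨fun h => hpe (hp.2 e h), hN.1⟩, by
    simpa using ⟨he, fun a b => hN.2 (a, b)⟩⟩

theorem Admissible.of_mem_linkChildren {D : Decomposition P k} {Δ : ℕ} (hΔ : 0 < Δ)
    {N N' : D.Node} (hN : D.Admissible Δ N) {p : Point n l} (hp : p ∈ D.nodeLP N) {q : Fin k}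
    (hN' : N' ∈ D.linkChildren Δ N p q) :
    D.Admissible Δ N' ∧ N'.length = N.length + 1 := by
  have hΔ' : (0 : ℝ) < Δ := by exact_mod_cast hΔ
  obtain ⟨j, -, rfl⟩ := Multiset.mem_map.1 hN'
  refine ⟨hN.cons hp (Or.inl ?_) (not_le.2 ?_), rfl⟩
  · exact Set.mem_iUnion.2 ⟨q, Set.mem_iUnion.2 ⟨j, ⟨_, ⟨p, hp.1, rfl⟩, rfl⟩⟩⟩
  -- Since ⌈t⌉ - 1 < t, the LP solution violates the new inequality.
  · rw [div_lt_iff₀ hΔ', mul_comm, sub_lt_iff_lt_add]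
    exact Int.ceil_lt_add_one _

theorem Admissible.objChild {D : Decomposition P k} {Δ : ℕ} (hΔ : 0 < Δ)
    {N : D.Node} (hN : D.Admissible Δ N) {p : Point n l} (hp : p ∈ D.nodeLP N) {q : Fin k}
    {v : D.BlockPoint q} (hv : v ∈ D.subFeasible N p q)
    (hlt : D.blockValue q (D.restrict q p) < D.blockValue q v) :
    D.Admissible Δ (D.objChild Δ N q (D.blockValue q v)) := by
  have hΔ' : (0 : ℝ) < Δ := by exact_mod_cast hΔ
  refine hN.cons hp (Or.inr ?_) (not_le.2 (hlt.trans_le ?_))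
  -- The value z* is the block value of a point of the LP polytope, namely of the LP solution with
  -- block `q` exchanged for `v`.
  · exact Set.mem_iUnion.2 ⟨q, ⟨_, ⟨D.exchange p q v, (D.exchange_mem_nodeLP hp hv).1, rfl⟩,
      by simp⟩⟩
  · rw [le_div_iff₀ hΔ', mul_comm]
    exact Int.le_ceil _

theorem card_linkChildren_le (Δ : ℕ) (N : D.Node) (p : Point n l) (q : Fin k) :
    Multiset.card (D.linkChildren Δ N p q) ≤ m := by
  simpa [linkChildren] using Fintype.card_subtype_le fun i => D.row i = none

/-- An iteration replaces a node by at most `m + 1` longer nodes. -/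
theorem Step.exists_children {D : Decomposition P k} {Δ : ℕ} (hΔ : 0 < Δ) {s s' : D.State}
    (h : D.Step Δ s s') (hs : ∀ N ∈ s.pending, D.Admissible Δ N) :
    ∃ (N : D.Node) (rest C : Multiset D.Node), s.pending = N ::ₘ rest ∧ s'.pending = C + rest ∧
      Multiset.card C ≤ m + 1 ∧ ∀ N' ∈ C, D.Admissible Δ N' ∧ N'.length = N.length + 1 := by
  cases h with
  | infeasible N rest | bound N rest | integral N rest | blocks N rest =>
    exact ⟨N, rest, 0, rfl, (zero_add _).symm, by simp, by simp⟩
  | branch N rest inc p hp hinc hy q v hv hlt =>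
    have hN := hs N (Multiset.mem_cons_self _ _)
    have hv' : v ∈ D.subFeasible N p q := by
      rcases hv with hv | hv
      · exact absurd hlt (by rw [hv.2]; exact lt_irrefl _)
      · exact hv.2.1
    refine ⟨N, rest, _, rfl, (Multiset.cons_add _ _ _).symm, ?_, fun N' hN' => ?_⟩
    · simpa using D.card_linkChildren_le Δ N p q
    · rcases Multiset.mem_cons.1 hN' with rfl | hN'
      · exact ⟨hN.objChild hΔ hp.1 hv' hlt, rfl⟩
      · exact hN.of_mem_linkChildren hΔ hp.1 hN'
  | branchInfeasible N rest inc p hp hinc hy q hq =>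
    exact ⟨N, rest, _, rfl, rfl, (D.card_linkChildren_le Δ N p q).trans (Nat.le_succ m),
      fun N' hN' => (hs N (Multiset.mem_cons_self _ _)).of_mem_linkChildren hΔ hp.1 hN'⟩

/-- A bound on the number of iterations that are still possible if nodes have at most `H`
branching inequalities. -/
def potential (H : ℕ) (s : D.State) : ℕ :=
  (s.pending.map fun N => (m + 2) ^ (H - N.length)).sum

theorem Step.potential_lt {D : Decomposition P k} {Δ : ℕ} (hΔ : 0 < Δ)
    (hbdd : Bornology.IsBounded P.lpFeasible) {s s' : D.State}
    (h : D.Step Δ s s') (hs : ∀ N ∈ s.pending, D.Admissible Δ N) :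
    D.potential (D.cuts Δ).ncard s' < D.potential (D.cuts Δ).ncard s := by
  obtain ⟨N, rest, C, hsN, hsC, hcard, hC⟩ := h.exists_children hΔ hs
  simp only [potential, hsN, hsC, Multiset.map_add, Multiset.sum_add, Multiset.map_cons,
    Multiset.sum_cons, add_lt_add_iff_right]
  set H := (D.cuts Δ).ncard
  -- Without children a positive power disappears. Otherwise a child exists, so its depth is at most
  -- `H` and the truncated subtraction in the exponent is exact.
  rcases C.empty_or_exists_mem with rfl | ⟨N₁, hN₁⟩
  · simp
  have hlt : N.length + 1 ≤ H := (hC N₁ hN₁).2 ▸ (hC N₁ hN₁).1.length_le hbdd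
  have hpow : H - N.length = (H - (N.length + 1)) + 1 := by omega
  calc (C.map fun N' => (m + 2) ^ (H - N'.length)).sum
      ≤ Multiset.card (C.map fun N' => (m + 2) ^ (H - N'.length)) •
          (m + 2) ^ (H - (N.length + 1)) := by
        refine Multiset.sum_le_card_nsmul _ _ fun a ha => ?_
        obtain ⟨N', hN', rfl⟩ := Multiset.mem_map.1 ha
        rw [(hC N' hN').2]
    _ ≤ (m + 1) * (m + 2) ^ (H - (N.length + 1)) := by
        rw [Multiset.card_map, smul_eq_mul]
        exact Nat.mul_le_mul_right _ hcard
    -- The base m + 2 exceeds the number m + 1 of possible children.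
    _ < (m + 2) ^ (H - N.length) := by
        rw [hpow, pow_succ, mul_comm]
        exact Nat.mul_lt_mul_of_pos_left (by omega) (by positivity)

theorem RunsTo.admissible {D : Decomposition P k} {Δ t : ℕ} (hΔ : 0 < Δ) {s : D.State}
    (h : D.RunsTo Δ t s) : ∀ N ∈ s.pending, D.Admissible Δ N := by
  induction h with
  | start => simp [init, Admissible]
  | next t s s' _ hstep ih =>
    obtain ⟨N, rest, C, hsN, hsC, -, hC⟩ := hstep.exists_children hΔ ih
    intro N' hN'
    rw [hsC, Multiset.mem_add] at hN'
    rcases hN' with hN' | hN'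
    · exact (hC N' hN').1
    · exact ih N' (by simp [hsN, hN'])

theorem RunsTo.add_potential_le {D : Decomposition P k} {Δ t : ℕ} (hΔ : 0 < Δ)
    (hbdd : Bornology.IsBounded P.lpFeasible) {s : D.State} (h : D.RunsTo Δ t s) :
    t + D.potential (D.cuts Δ).ncard s ≤ D.potential (D.cuts Δ).ncard D.init := by
  induction h with
  | start => simp
  | next t s s' hrun hstep ih =>
    have := hstep.potential_lt hΔ hbdd (hrun.admissible hΔ)
    omega

end Decomposition

end DecBranch

theorem mainTheorem1 {m n l k : ℕ} (P : DecBranch.MIP m n l) (D : DecBranch.Decomposition P k)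
    (Δ : ℕ) (hΔ : 0 < Δ)
    (hreg : DecBranch.IsDeltaRegular Δ (P.A.map (Int.cast : ℤ → ℚ)))
    (hpoly : Bornology.IsBounded P.lpFeasible) :
    -- termination: the number of iterations of all runs is bounded
    (∃ T : ℕ, ∀ (t : ℕ) (s : D.State), D.RunsTo Δ t s → t ≤ T) ∧
    -- as long as nodes are pending, the algorithm can proceed
    (∀ (t : ℕ) (s : D.State), D.RunsTo Δ t s → s.pending ≠ 0 → ∃ s', D.Step Δ s s') ∧
    -- exactness: whenever no node is pending, the result is correct
    (∀ (t : ℕ) (s : D.State), D.RunsTo Δ t s → s.pending = 0 →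
      (∀ p, s.incumbent = some p → P.IsOptimal p) ∧
      (s.incumbent = none ↔ P.feasible = ∅)) := by
  refine ⟨⟨D.potential (D.cuts Δ).ncard D.init, fun t s h => ?_⟩,
    fun t s _ hs => D.exists_step hpoly Δ hs, fun t s h hs => h.exactness hΔ hreg hpoly hs⟩
  exact (Nat.le_add_right _ _).trans (h.add_potential_le hΔ hpoly)
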